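/- For an uncountable cardinal $\kappa$ (identified with the set of ordinals below its initial ordinal), let $[\kappa]^{\omega}$ be the set of all countable subsets of $\kappa$. A set $C\subseteq[\kappa]^{\omega}$ is closed unbounded (club) if it is cofinal in $[\kappa]^\omega$ with respect to inclusion and closed under unions of increasing countable chains; $S\subseteq[\kappa]^{\omega}$ is stationary if it meets every club. When $x\cap\omega_1$ is a countable ordinal, write $\delta_x=x\cap\omega_1$. A set $S\subseteq[\kappa]^{\omega}$ is projective stationary if for every stationary $A\subseteq\omega_1$ the set $\{x\in S : \delta_x \text{ is defined and } \delta_x\in A\}$ is stationary in $[\kappa]^{\omega}$. An $\omega_1$-chain is a sequence $\langle x_\alpha : \alpha<\omega_1\rangle$ in $[\kappa]^{\omega}$ that is $\subseteq$-increasing, continuous ($x_\alpha=\bigcup_{\beta<\alpha}x_\beta$ for limit $\alpha$), and such that every $\delta_{x_\alpha}$ is defined and $\delta_{x_\alpha}<\delta_{x_\beta}$ whenever $\alpha<\beta$. The Strong Reflection Principle (SRP) states that for every cardinal $\kappa>\omega_1$, every projective stationary set $S\subseteq[\kappa]^{\omega}$ contains an $\omega_1$-chain (i.e. there is an $\omega_1$-chain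 all of whose members belong to $S$). **Corollary 7.2.** Assume SRP. Then for every uncountable cardinal $\kappa$ and every stationary set $S\subseteq[\kappa]^{\omega}$, the set $$\{\text{order-type}(x\cap\omega_2) : x\in S\}$$ is stationary in $\omega_1$. -/

import Mathlib

open scoped Cardinal Ordinal

universe u

namespace CountableSubsets

/-- `[κ]^ω`: the countable subsets of the cardinal `κ`, where `κ` is identified with the set of
ordinals below its initial ordinal. -/
def ctbl (κ : Cardinal.{u}) : Set (Set Ordinal.{u}) :=
  {x | x ⊆ Set.Iio κ.ord ∧ x.Countable}

/-- Closed unbounded subsets of `[κ]^ω`: cofinal with respect to inclusion, and closed under unions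
of increasing countable chains (every nonempty countable chain has the same union as an increasing
sequence indexed by the natural numbers). -/
structure IsClubIn (κ : Cardinal.{u}) (C : Set (Set Ordinal.{u})) : Prop where
  subset : C ⊆ ctbl κ
  cofinal : ∀ x ∈ ctbl κ, ∃ y ∈ C, x ⊆ y
  iUnion_mem : ∀ f : ℕ → Set Ordinal.{u}, Monotone f → (∀ n, f n ∈ C) → (⋃ n, f n) ∈ C

/-- Stationary subsets of `[κ]^ω`: those that meet every closed unbounded subset. -/
structure IsStationaryIn (κ : Cardinal.{u}) (S : Set (Set Ordinal.{u})) : Prop where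
  subset : S ⊆ ctbl κ
  inter_nonempty : ∀ C, IsClubIn κ C → (S ∩ C).Nonempty

/-- `HasDelta x δ`: the set `x ∩ ω₁` is the countable ordinal `δ`, that is, `δ_x` is defined and
equal to `δ`. -/
def HasDelta (x : Set Ordinal.{u}) (δ : Set.Iio (ω₁ : Ordinal.{u})) : Prop :=
  x ∩ Set.Iio ω₁ = Set.Iio (δ : Ordinal.{u})

/-- `S ⊆ [κ]^ω` is projective stationary: for every stationary `A ⊆ ω₁`, the set
`{x ∈ S | δ_x ∈ A}` is stationary in `[κ]^ω`. -/
structure IsProjectiveStationary (κ : Cardinal.{u}) (S : Set (Set Ordinal.{u})) : Prop where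
  subset : S ⊆ ctbl κ
  stationary : ∀ A : Set (Set.Iio (ω₁ : Ordinal.{u})), IsStationary A →
    IsStationaryIn κ {x ∈ S | ∃ δ ∈ A, HasDelta x δ}

/-- An `ω₁`-chain in `[κ]^ω`: a sequence `⟨x_α : α < ω₁⟩` that is increasing, continuous at limits,
and such that every `δ_{x_α}` is defined, with `δ_{x_α} < δ_{x_β}` for `α < β`. -/
structure IsOmegaOneChain (κ : Cardinal.{u})
    (x : Set.Iio (ω₁ : Ordinal.{u}) → Set Ordinal.{u}) : Prop where
  mem : ∀ α, x α ∈ ctbl κ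
  mono : Monotone x
  continuous : ∀ α : Set.Iio (ω₁ : Ordinal.{u}), Order.IsSuccLimit (α : Ordinal.{u}) →
    x α = ⋃ β, ⋃ (_ : β < α), x β
  delta : ∃ δ : Set.Iio (ω₁ : Ordinal.{u}) → Set.Iio (ω₁ : Ordinal.{u}),
    StrictMono δ ∧ ∀ α, HasDelta (x α) (δ α)

/-- The Strong Reflection Principle: for every cardinal `κ > ω₁`, every projective stationary
subset of `[κ]^ω` contains an `ω₁`-chain. -/
def SRP : Prop :=
  ∀ κ : Cardinal.{u}, ℵ₁ < κ → ∀ S : Set (Set Ordinal.{u}), IsProjectiveStationary κ S →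
    ∃ x : Set.Iio (ω₁ : Ordinal.{u}) → Set Ordinal.{u}, IsOmegaOneChain κ x ∧ ∀ α, x α ∈ S

/-- `{order-type(x ∩ ω₂) : x ∈ S}` as a set of countable ordinals. The order type of a set of
ordinals of one universe is an ordinal of the next universe, hence the `lift`. -/
def orderTypes (S : Set (Set Ordinal.{u})) : Set (Set.Iio (ω₁ : Ordinal.{u})) :=
  {o | ∃ x ∈ S, Ordinal.lift.{u + 1} (o : Ordinal.{u}) =
    typeLT (x ∩ Set.Iio (ω_ 2) : Set Ordinal.{u})}

end CountableSubsets

/-! For `η < ω₂` an injection `η → ω₁` yields a canonical function on `ω₁`. If `x` is closed under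
these injections and their inverses, then `δ_x` determines `x ∩ η` for every `η ∈ x ∩ ω₂`, and its
order type is `canonical η δ_x` (`Coherent.otype_inter_Iio`). The order type of `x ∩ ω₂` is thus
governed by the values at `δ_x` of the canonical functions indexed by `x`.

SRP makes the nonstationary ideal on `ω₁` saturated (`IsPredense.exists_subset`), and saturation
bounds every function `ω₁ → ω₁` by some canonical function on a club (`exists_lt_canonical`). Given
a club `C ⊆ ω₁`, let `h η` take values in `C` above `canonical η`, and choose `β η < ω₂` whose
canonical function exceeds `h η` on a club. For `x` in the stationary set with enough closure, the
ordinals `h η δ_x` with `η ∈ x ∩ ω₂` interleave with the values `canonical η δ_x`, so their supremum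
is the order type of `x ∩ ω₂`. As `C` is closed, it contains this order type. For `κ = ℵ₁` no
reflection is needed. -/

namespace CountableSubsets

/-! ### Clubs and stationary sets in `ω₁` -/

/-- The countable ordinals. -/
abbrev Omega1 : Type (u + 1) := Set.Iio (ω₁ : Ordinal.{u})

theorem cof_omega1 : Order.cof Omega1.{u} ≠ ℵ₀ := by
  rw [Ordinal.cof_Iio, ← Ordinal.lift_cof, Cardinal.cof_omega_one, Cardinal.lift_aleph]
  simpa using Cardinal.aleph0_lt_aleph_one.ne'

instance : Nonempty Omega1.{u} := ⟨⟨0, Ordinal.omega_pos 1⟩⟩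

theorem exists_gt_of_countable {s : Set Omega1.{u}} (hs : s.Countable) : ∃ a, ∀ b ∈ s, b < a := by
  have := hs.to_subtype
  have h : (⨆ b : s, Order.succ (b : Ordinal.{u})) < ω₁ := by
    apply Ordinal.iSup_lt_omega_one
    intro i
    exact (Cardinal.isSuccLimit_omega 1).succ_lt i.1.2
  refine ⟨⟨_, h⟩, fun b hb ↦ Subtype.coe_lt_coe.1 ?_⟩
  have := Ordinal.le_iSup (fun b : s ↦ Order.succ (b : Ordinal.{u})) ⟨b, hb⟩
  exact (Order.lt_succ _).trans_le this

instance : NoMaxOrder Omega1.{u} where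
  exists_gt a := by
    obtain ⟨b, hb⟩ := exists_gt_of_countable (Set.countable_singleton a)
    exact ⟨b, hb a rfl⟩

theorem countable_Iio_of_lt_omega_one {o : Ordinal.{u}} (ho : o < ω₁) :
    (Set.Iio o).Countable := by
  rw [← Cardinal.le_aleph0_iff_set_countable, Cardinal.mk_Iio_ordinal]
  rw [Cardinal.lift_le_aleph0, ← Cardinal.lt_aleph_one_iff]
  rwa [← Cardinal.lt_ord, Cardinal.ord_aleph]

theorem countable_Iio_omega1 (a : Omega1.{u}) : (Set.Iio a).Countable := by
  have := (countable_Iio_of_lt_omega_one a.2).preimage (f := fun b : Omega1.{u} ↦ (b : Ordinal.{u}))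
    Subtype.val_injective
  exact this

theorem countable_Iic_omega1 (a : Omega1.{u}) : (Set.Iic a).Countable := by
  obtain ⟨b, hb⟩ := exists_gt a
  exact (countable_Iio_omega1 b).mono fun c hc ↦ lt_of_le_of_lt hc hb

theorem exists_isLUB_of_countable {s : Set Omega1.{u}} (hs : s.Countable) : ∃ a, IsLUB s a := by
  obtain ⟨a, ha⟩ := exists_gt_of_countable hs
  have hne : (upperBounds s).Nonempty := ⟨a, fun b hb ↦ (ha b hb).le⟩
  exact ⟨wellFounded_lt.min _ hne, wellFounded_lt.min_mem _ hne,
    fun b hb ↦ not_lt.1 (wellFounded_lt.not_lt_min _ hb)⟩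

/-- The positive ordinals closed under a function. -/
def closurePoints (g : Omega1.{u} → Omega1.{u}) : Set Omega1.{u} :=
  {a | (∃ b, b < a) ∧ ∀ b < a, g b < a}

theorem isClub_closurePoints (g : Omega1.{u} → Omega1.{u}) : IsClub (closurePoints g) where
  dirSupClosed := by
    intro d hd ⟨e, he⟩ _ a ha
    refine ⟨?_, fun b hb ↦ ?_⟩
    · obtain ⟨b, hb⟩ := (hd he).1
      exact ⟨b, hb.trans_le (ha.1 he)⟩
    · obtain ⟨c, hc, hbc⟩ := (lt_isLUB_iff ha).1 hb
      exact ((hd hc).2 b hbc).trans_le (ha.1 hc)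
  isCofinal := by
    intro a
    have h : ∀ a, ∃ c, ∀ b ≤ a, b < c ∧ g b < c := by
      intro a
      obtain ⟨c, hc⟩ := exists_gt_of_countable
        ((countable_Iic_omega1 a).union ((countable_Iic_omega1 a).image g))
      exact ⟨c, fun b hb ↦ ⟨hc b (.inl hb), hc _ (.inr ⟨b, hb, rfl⟩)⟩⟩
    choose G hG using h
    let s : ℕ → Omega1.{u} := fun n ↦ G^[n] a
    have hs : ∀ n, s (n + 1) = G (s n) := fun n ↦ Function.iterate_succ_apply' G n a
    obtain ⟨c, hc⟩ := exists_isLUB_of_countable (Set.countable_range s)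
    refine ⟨c, ⟨⟨a, (hG a a le_rfl).1.trans_le (hc.1 ⟨1, rfl⟩)⟩, fun b hb ↦ ?_⟩, hc.1 ⟨0, rfl⟩⟩
    obtain ⟨_, ⟨n, rfl⟩, hn⟩ := (lt_isLUB_iff hc).1 hb
    refine (hG (s n) b hn.le).2.trans_le ?_
    rw [← hs]
    exact hc.1 ⟨n + 1, rfl⟩

theorem exists_gt_of_mem_closurePoints {g : Omega1.{u} → Omega1.{u}} (hg : ∀ a, a < g a)
    {a b : Omega1.{u}} (ha : a ∈ closurePoints g) (hb : b < a) : ∃ c < a, b < c :=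
  ⟨g b, ha.2 b hb, hg b⟩

theorem isSuccLimit_of_mem_closurePoints {g : Omega1.{u} → Omega1.{u}} (hg : ∀ a, a < g a)
    {a : Omega1.{u}} (ha : a ∈ closurePoints g) : Order.IsSuccLimit (a : Ordinal.{u}) := by
  refine ⟨?_, ?_⟩
  · obtain ⟨b, hb⟩ := ha.1
    exact fun h ↦ h.not_lt (Subtype.coe_lt_coe.2 hb)
  · intro b hb
    have hba : b < (a : Ordinal.{u}) := hb.lt
    obtain ⟨c, hc, hbc⟩ := exists_gt_of_mem_closurePoints (b := ⟨b, hba.trans a.2⟩) hg ha hba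
    exact hb.2 (Subtype.coe_lt_coe.2 hbc) (Subtype.coe_lt_coe.2 hc)

/-- Clubs in `ω₁` are closed under diagonal intersection, which is what Fodor's lemma rests on. -/
theorem isClub_diagonal {C : Omega1.{u} → Set Omega1.{u}} (hC : ∀ a, IsClub (C a)) :
    IsClub {a | ∀ b < a, a ∈ C b} where
  dirSupClosed := by
    intro d hd hne _ a ha b hb
    obtain ⟨c, hc, hbc⟩ := (lt_isLUB_iff ha).1 hb
    refine (hC b).isLUB_mem (t := d ∩ Set.Ioi b) ?_ ⟨c, hc, hbc⟩ ?_
    · exact fun e he ↦ hd he.1 b he.2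
    · refine ⟨fun e he ↦ ha.1 he.1, fun e he ↦ ha.2 fun f hf ↦ ?_⟩
      obtain hfb | hfb := lt_or_ge b f
      · exact he ⟨hf, hfb⟩
      · exact hfb.trans (hbc.le.trans (he ⟨hc, hbc⟩))
  isCofinal := by
    have h : ∀ a, ∃ c, a < c ∧ ∀ b ≤ a, c ∈ C b := by
      intro a
      have : Countable (Set.Iic a) := (countable_Iic_omega1 a).to_subtype
      have h := IsClub.iInter_of_countable cof_omega1 fun b : Set.Iic a ↦ hC b
      obtain ⟨a', ha'⟩ := exists_gt a
      obtain ⟨c, hc, hac⟩ := h.isCofinal a'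
      exact ⟨c, ha'.trans_le hac, fun b hb ↦ Set.mem_iInter.1 hc ⟨b, hb⟩⟩
    choose g hg hgC using h
    intro a
    obtain ⟨c, hc, hac⟩ := (isClub_closurePoints g).isCofinal a
    refine ⟨c, fun b hb ↦ ?_, hac⟩
    -- As `c` is closed under `g`, the points `g d` with `b ≤ d < c` are cofinal in `c`, and all of
    -- them lie in `C b`.
    refine (hC b).isLUB_mem (t := g '' Set.Ico b c) ?_ ⟨g b, b, ⟨le_rfl, hb⟩, rfl⟩ ⟨?_, ?_⟩
    · rintro _ ⟨d, hd, rfl⟩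
      exact hgC d b hd.1
    · rintro _ ⟨d, hd, rfl⟩
      exact (hc.2 d hd.2).le
    · intro e he
      by_contra! hec
      have := he ⟨max b e, ⟨le_max_left _ _, max_lt hb hec⟩, rfl⟩
      exact ((le_max_right b e).trans_lt (hg _)).not_ge this

theorem _root_.IsStationary.inter_isClub {A C : Set Omega1.{u}} (hA : IsStationary A)
    (hC : IsClub C) : IsStationary (A ∩ C) := by
  intro D hD
  rw [Set.inter_assoc]
  exact hA (hC.inter cof_omega1 hD)

/-- Fodor's lemma. -/
theorem exists_isStationary_fiber {A : Set Omega1.{u}} (hA : IsStationary A)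
    (P : Omega1.{u} → Omega1.{u} → Prop) (hP : ∀ a ∈ A, ∃ b < a, P a b) :
    ∃ b, IsStationary {a ∈ A | P a b} := by
  by_contra! h
  simp_rw [not_isStationary_iff] at h
  choose C hC hAC using h
  obtain ⟨a, haA, haC⟩ := hA (isClub_diagonal hC)
  obtain ⟨b, hb, hab⟩ := hP a haA
  exact (hAC b).notMem_of_mem_left ⟨haA, hab⟩ (haC b hb)

theorem exists_isStationary_of_countable {ι : Type*} {s : Set ι} (hs : s.Countable)
    {A : Set Omega1.{u}} (hA : IsStationary A) (P : Omega1.{u} → ι → Prop)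
    (hP : ∀ a ∈ A, ∃ i ∈ s, P a i) : ∃ i ∈ s, IsStationary {a ∈ A | P a i} := by
  have := hs.to_subtype
  have h : IsStationary (⋃ i : s, {a ∈ A | P a i}) := by
    refine hA.mono fun a ha ↦ ?_
    obtain ⟨i, hi, h⟩ := hP a ha
    exact Set.mem_iUnion.2 ⟨⟨i, hi⟩, ha, h⟩
  obtain ⟨i, hi⟩ := (isStationary_iUnion_iff_of_countable cof_omega1).1 h
  exact ⟨i, i.2, hi⟩

/-! ### Clubs in `[κ]^ω` and closure under functions -/

/-- `x` is closed under a set-valued function of finitely many arguments. -/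
def ClosedUnder (F : List Ordinal.{u} → Set Ordinal.{u}) (x : Set Ordinal.{u}) : Prop :=
  ∀ l : List Ordinal.{u}, (∀ a ∈ l, a ∈ x) → F l ⊆ x

/-- `F` maps finite sequences in `κ` to countable subsets of `κ`. -/
def MapsToCtbl (κ : Cardinal.{u}) (F : List Ordinal.{u} → Set Ordinal.{u}) : Prop :=
  ∀ l : List Ordinal.{u}, (∀ a ∈ l, a < κ.ord) → F l ∈ ctbl κ

theorem countable_lists {x : Set Ordinal.{u}} (hx : x.Countable) :
    {l : List Ordinal.{u} | ∀ a ∈ l, a ∈ x}.Countable := by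
  have := hx.to_subtype
  refine (Set.countable_range fun l : List x ↦ l.map Subtype.val).mono fun l hl ↦ ?_
  exact ⟨l.attachWith (· ∈ x) hl, by simp⟩

theorem iUnion_mem_ctbl {κ : Cardinal.{u}} {ι : Sort*} [Countable ι] {f : ι → Set Ordinal.{u}}
    (hf : ∀ i, f i ∈ ctbl κ) : (⋃ i, f i) ∈ ctbl κ :=
  ⟨Set.iUnion_subset fun i ↦ (hf i).1, Set.countable_iUnion fun i ↦ (hf i).2⟩

theorem union_mem_ctbl {κ : Cardinal.{u}} {x y : Set Ordinal.{u}} (hx : x ∈ ctbl κ)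
    (hy : y ∈ ctbl κ) : x ∪ y ∈ ctbl κ :=
  ⟨Set.union_subset hx.1 hy.1, hx.2.union hy.2⟩

theorem biUnion_mem_ctbl {κ : Cardinal.{u}} {ι : Type*} {s : Set ι} (hs : s.Countable)
    {f : ι → Set Ordinal.{u}} (hf : ∀ i ∈ s, f i ∈ ctbl κ) : (⋃ i ∈ s, f i) ∈ ctbl κ :=
  ⟨Set.iUnion₂_subset fun i hi ↦ (hf i hi).1, hs.biUnion fun i hi ↦ (hf i hi).2⟩

theorem ClosedUnder.iUnion_of_directed {F : List Ordinal.{u} → Set Ordinal.{u}} {ι : Type*}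
    [Nonempty ι] {f : ι → Set Ordinal.{u}} (hd : Directed (· ⊆ ·) f)
    (hf : ∀ i, ClosedUnder F (f i)) : ClosedUnder F (⋃ i, f i) := by
  intro l hl
  have h : ∃ i, ∀ a ∈ l, a ∈ f i := by
    induction l with
    | nil => exact ⟨Classical.arbitrary ι, by simp⟩
    | cons a l ih =>
      obtain ⟨i, hi⟩ := ih fun b hb ↦ hl b (by simp [hb])
      obtain ⟨j, hj⟩ := Set.mem_iUnion.1 (hl a (by simp))
      obtain ⟨k, hik, hjk⟩ := hd i j
      refine ⟨k, fun b hb ↦ ?_⟩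
      obtain rfl | hb := List.mem_cons.1 hb
      exacts [hjk hj, hik (hi b hb)]
  obtain ⟨i, hi⟩ := h
  exact (hf i l hi).trans (Set.subset_iUnion f i)

theorem exists_closedUnder {κ : Cardinal.{u}} {F : List Ordinal.{u} → Set Ordinal.{u}}
    (hF : MapsToCtbl κ F) {y : Set Ordinal.{u}} (hy : y ∈ ctbl κ) :
    ∃ z ∈ ctbl κ, ClosedUnder F z ∧ y ⊆ z := by
  let G : Set Ordinal.{u} → Set Ordinal.{u} := fun x ↦ x ∪ ⋃ l ∈ {l | ∀ a ∈ l, a ∈ x}, F l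
  let s : ℕ → Set Ordinal.{u} := fun n ↦ G^[n] y
  have hs : ∀ n, s (n + 1) = G (s n) := fun n ↦ Function.iterate_succ_apply' G n y
  have hmono : Monotone s := monotone_nat_of_le_succ fun n ↦ by
    rw [hs]
    exact Set.subset_union_left
  have hmem : ∀ n, s n ∈ ctbl κ := by
    intro n
    induction n with
    | zero => exact hy
    | succ n ih =>
      rw [hs]
      exact union_mem_ctbl ih (biUnion_mem_ctbl (countable_lists ih.2) fun l hl ↦
        hF l fun a ha ↦ ih.1 (hl a ha))
  refine ⟨⋃ n, s n, iUnion_mem_ctbl hmem, fun l hl ↦ ?_, Set.subset_iUnion s 0⟩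
  have h : ∃ n, ∀ a ∈ l, a ∈ s n := by
    induction l with
    | nil => exact ⟨0, by simp⟩
    | cons a l ih =>
      obtain ⟨i, hi⟩ := ih fun b hb ↦ hl b (by simp [hb])
      obtain ⟨j, hj⟩ := Set.mem_iUnion.1 (hl a (by simp))
      refine ⟨max i j, fun b hb ↦ ?_⟩
      obtain rfl | hb := List.mem_cons.1 hb
      exacts [hmono (le_max_right i j) hj, hmono (le_max_left i j) (hi b hb)]
  obtain ⟨n, hn⟩ := h
  refine Set.Subset.trans ?_ (Set.subset_iUnion s (n + 1))
  rw [hs]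
  exact Set.subset_union_of_subset_right (Set.subset_biUnion_of_mem (s := {l | ∀ a ∈ l, a ∈ s n}) (u := F) hn) _

theorem isClubIn_closedUnder {κ : Cardinal.{u}} {F : List Ordinal.{u} → Set Ordinal.{u}}
    (hF : MapsToCtbl κ F) : IsClubIn κ {x ∈ ctbl κ | ClosedUnder F x} where
  subset _ hx := hx.1
  cofinal y hy := by
    obtain ⟨z, hz, hzF, hyz⟩ := exists_closedUnder hF hy
    exact ⟨z, ⟨hz, hzF⟩, hyz⟩
  iUnion_mem f hf hfC := ⟨iUnion_mem_ctbl fun n ↦ (hfC n).1,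
    .iUnion_of_directed hf.directed_le fun n ↦ (hfC n).2⟩

/-- Choose `F l` in `C` by recursion on the list, containing the head and the value at the tail. If
`x` is countable and closed under `F`, the lists of initial terms of an enumeration of `x` give an
increasing sequence in `C` with union `x`. -/
theorem IsClubIn.exists_closedUnder {κ : Cardinal.{u}} {C : Set (Set Ordinal.{u})}
    (hC : IsClubIn κ C) :
    ∃ F, MapsToCtbl κ F ∧ ∀ x ∈ ctbl κ, ClosedUnder F x → x ∈ C := by
  have hpick : ∀ x, ∃ y, x ∈ ctbl κ → y ∈ C ∧ x ⊆ y := by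
    intro x
    by_cases hx : x ∈ ctbl κ
    · obtain ⟨y, hy⟩ := hC.cofinal x hx
      exact ⟨y, fun _ ↦ hy⟩
    · exact ⟨∅, fun h ↦ (hx h).elim⟩
  choose pick hpick using hpick
  let F : List Ordinal.{u} → Set Ordinal.{u} :=
    fun l ↦ l.rec (pick ∅) fun a _ y ↦ pick (insert a y)
  have hnil : (∅ : Set Ordinal.{u}) ∈ ctbl κ := ⟨Set.empty_subset _, Set.countable_empty⟩
  have hcons : ∀ a < κ.ord, ∀ l, F l ∈ C → insert a (F l) ∈ ctbl κ := fun a ha l hl ↦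
    ⟨Set.insert_subset ha (hC.subset hl).1, (hC.subset hl).2.insert a⟩
  have hF : ∀ l : List Ordinal.{u}, (∀ a ∈ l, a < κ.ord) → F l ∈ C := by
    intro l hl
    induction l with
    | nil => exact (hpick _ hnil).1
    | cons a l ih =>
      exact (hpick _ (hcons a (hl a (by simp)) l (ih fun b hb ↦ hl b (by simp [hb])))).1
  refine ⟨F, fun l hl ↦ hC.subset (hF l hl), fun x hx hxF ↦ ?_⟩
  -- The empty set has no enumeration, but closure forces `F [] = ∅`, and `F [] ∈ C`.
  obtain rfl | hne := x.eq_empty_or_nonempty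
  · have h : F [] ⊆ ∅ := hxF [] (by simp)
    rw [← Set.subset_empty_iff.1 h]
    exact hF [] (by simp)
  obtain ⟨e, rfl⟩ := hx.2.exists_eq_range hne
  let L : ℕ → List Ordinal.{u} := fun n ↦ n.rec [] fun n l ↦ e n :: l
  have hLe : ∀ n, ∀ a ∈ L n, a ∈ Set.range e := by
    intro n
    induction n with
    | zero => simp [L]
    | succ n ih =>
      intro a ha
      obtain rfl | ha := List.mem_cons.1 ha
      exacts [⟨n, rfl⟩, ih a ha]
  have hLC : ∀ n, F (L n) ∈ C := fun n ↦ hF _ fun a ha ↦ hx.1 (hLe n a ha)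
  have hstep : ∀ n, insert (e n) (F (L n)) ⊆ F (L (n + 1)) := fun n ↦
    (hpick _ (hcons (e n) (hx.1 ⟨n, rfl⟩) (L n) (hLC n))).2
  have heq : Set.range e = ⋃ n, F (L n) := by
    refine Set.Subset.antisymm ?_ (Set.iUnion_subset fun n ↦ hxF _ (hLe n))
    rintro _ ⟨n, rfl⟩
    exact Set.mem_iUnion.2 ⟨n + 1, hstep n (Set.mem_insert _ _)⟩
  rw [heq]
  exact hC.iUnion_mem _ (monotone_nat_of_le_succ fun n ↦
    (Set.subset_insert _ _).trans (hstep n)) hLC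

/-- The closure of a set under a set-valued function. -/
def closureUnder (F : List Ordinal.{u} → Set Ordinal.{u}) (y : Set Ordinal.{u}) :
    Set Ordinal.{u} :=
  ⋂₀ {z | ClosedUnder F z ∧ y ⊆ z}

theorem subset_closureUnder (F : List Ordinal.{u} → Set Ordinal.{u}) (y : Set Ordinal.{u}) :
    y ⊆ closureUnder F y :=
  Set.subset_sInter fun _ hz ↦ hz.2

theorem closureUnder_subset {F : List Ordinal.{u} → Set Ordinal.{u}} {y z : Set Ordinal.{u}}
    (hz : ClosedUnder F z) (hyz : y ⊆ z) : closureUnder F y ⊆ z :=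
  Set.sInter_subset_of_mem ⟨hz, hyz⟩

theorem closedUnder_closureUnder (F : List Ordinal.{u} → Set Ordinal.{u}) (y : Set Ordinal.{u}) :
    ClosedUnder F (closureUnder F y) := fun l hl ↦
  Set.subset_sInter fun _ hz ↦ hz.1 l fun a ha ↦ hl a ha _ hz

theorem closureUnder_mono (F : List Ordinal.{u} → Set Ordinal.{u}) : Monotone (closureUnder F) :=
  fun _ y hxy ↦ closureUnder_subset (closedUnder_closureUnder F y)
    (hxy.trans (subset_closureUnder F y))

theorem closureUnder_mem_ctbl {κ : Cardinal.{u}} {F : List Ordinal.{u} → Set Ordinal.{u}}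
    (hF : MapsToCtbl κ F) {y : Set Ordinal.{u}} (hy : y ∈ ctbl κ) : closureUnder F y ∈ ctbl κ := by
  obtain ⟨z, hz, hzF, hyz⟩ := CountableSubsets.exists_closedUnder hF hy
  have h := closureUnder_subset hzF hyz
  exact ⟨h.trans hz.1, hz.2.mono h⟩

theorem omega_one_le_ord {κ : Cardinal.{u}} (hκ : ℵ₁ ≤ κ) : ω₁ ≤ κ.ord := by
  rw [← Cardinal.ord_aleph]
  exact Cardinal.ord_le_ord.2 hκ

theorem Iio_mem_ctbl {κ : Cardinal.{u}} (hκ : ℵ₁ ≤ κ) {o : Ordinal.{u}} (ho : o < ω₁) :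
    Set.Iio o ∈ ctbl κ :=
  ⟨fun _ ha ↦ lt_trans ha (ho.trans_le (omega_one_le_ord hκ)), countable_Iio_of_lt_omega_one ho⟩

/-- The countable set `x` generated by `a` and `y` has `δ_x = a` for club many `a < ω₁`. -/
theorem exists_closedUnder_hasDelta {κ : Cardinal.{u}} (hκ : ℵ₁ ≤ κ)
    {F : List Ordinal.{u} → Set Ordinal.{u}} (hF : MapsToCtbl κ F) {y : Set Ordinal.{u}}
    (hy : y ∈ ctbl κ) {A : Set Omega1.{u}} (hA : IsStationary A) :
    ∃ x ∈ ctbl κ, ClosedUnder F x ∧ y ⊆ x ∧ ∃ δ ∈ A, HasDelta x δ := by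
  let cl : Omega1.{u} → Set Ordinal.{u} := fun a ↦ closureUnder F (Set.Iio (a : Ordinal.{u}) ∪ y)
  have hcl : ∀ a, cl a ∈ ctbl κ := fun a ↦
    closureUnder_mem_ctbl hF (union_mem_ctbl (Iio_mem_ctbl hκ a.2) hy)
  have hmono : Monotone cl := fun a b hab ↦ closureUnder_mono F <|
    Set.union_subset_union_left _ <| Set.Iio_subset_Iio hab
  have h : ∀ a, ∃ b, a < b ∧ ∀ c : Omega1.{u}, (c : Ordinal.{u}) ∈ cl a → c < b := by
    intro a
    obtain ⟨b, hb⟩ := exists_gt_of_countable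
      (((hcl a).2.preimage (f := fun c : Omega1.{u} ↦ (c : Ordinal.{u}))
        Subtype.val_injective).insert a)
    exact ⟨b, hb a (Set.mem_insert _ _), fun c hc ↦ hb c (Set.mem_insert_of_mem _ hc)⟩
  choose g hg hgcl using h
  obtain ⟨a, haA, hag⟩ := hA (isClub_closurePoints g)
  refine ⟨cl a, hcl a, closedUnder_closureUnder F _,
    Set.subset_union_right.trans (subset_closureUnder F _), a, haA, ?_⟩
  have hne : Nonempty (Set.Iio a) := let ⟨b, hb⟩ := hag.1; ⟨b, hb⟩
  -- The closure is continuous at `a`, so a countable ordinal in `cl a` already lies in some `cl b`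
  -- with `b < a`, hence is below `g b < a`.
  have hsub : cl a ⊆ ⋃ b : Set.Iio a, cl b := by
    refine closureUnder_subset (.iUnion_of_directed ?_ fun b ↦ closedUnder_closureUnder F _) ?_
    · exact Monotone.directed_le fun b c hbc ↦ hmono hbc
    · rintro b (hb | hb)
      · obtain ⟨c, hca, hbc⟩ :=
          exists_gt_of_mem_closurePoints (b := ⟨b, (Set.mem_Iio.1 hb).trans a.2⟩) hg hag hb
        exact Set.mem_iUnion.2 ⟨⟨c, hca⟩, subset_closureUnder F _ (.inl hbc)⟩
      · exact Set.mem_iUnion.2 ⟨hne.some, subset_closureUnder F _ (.inr hb)⟩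
  refine Set.Subset.antisymm ?_ fun b hb ↦ ⟨subset_closureUnder F _ (.inl hb), (Set.mem_Iio.1 hb).trans a.2⟩
  rintro b ⟨hb, hb1⟩
  obtain ⟨c, hc⟩ := Set.mem_iUnion.1 (hsub hb)
  exact lt_trans (hgcl c ⟨b, hb1⟩ hc : (⟨b, hb1⟩ : Omega1.{u}) < g c) (hag.2 c c.2)

/-! ### Saturation of the nonstationary ideal -/

/-- Every stationary set has stationary intersection with a member of the family. -/
def IsPredense (𝓐 : Set (Set Omega1.{u})) : Prop :=
  ∀ A, IsStationary A → ∃ B ∈ 𝓐, IsStationary (A ∩ B)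

theorem HasDelta.unique {x : Set Ordinal.{u}} {δ ε : Omega1.{u}} (hδ : HasDelta x δ)
    (hε : HasDelta x ε) : δ = ε :=
  Subtype.ext (Set.Iio_injective (hδ.symm.trans hε))

theorem exists_enumeration : ∃ e : Ordinal.{u} → Set Omega1.{u},
    ∀ B, ∃ j < ((2 : Cardinal.{u}) ^ (ℵ₁ : Cardinal.{u})).ord, e j = B := by
  have h : #(Set Omega1.{u}) ≤ #(Set.Iio ((2 : Cardinal.{u}) ^ (ℵ₁ : Cardinal.{u})).ord) := by
    rw [Cardinal.mk_set, Cardinal.mk_Iio_ordinal, Cardinal.mk_Iio_ordinal, Cardinal.card_ord]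
    simp
  obtain ⟨f⟩ := h
  have hf : Function.Injective fun B ↦ (f B : Ordinal.{u}) := Subtype.val_injective.comp f.injective
  exact ⟨Function.extend (fun B ↦ (f B : Ordinal.{u})) id fun _ ↦ ∅, fun B ↦
    ⟨f B, (f B).2, hf.extend_apply id (fun _ ↦ ∅) B⟩⟩

/-- Take limits `a` closed under a function dominating `δ`. If `a < δ a`, continuity puts `a` in
some `x b` with `b < a`, giving `a < δ b < a`. -/
theorem IsOmegaOneChain.exists_isClub_hasDelta {κ : Cardinal.{u}} {x : Omega1.{u} → Set Ordinal.{u}}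
    (hx : IsOmegaOneChain κ x) : ∃ C, IsClub C ∧ ∀ a ∈ C, HasDelta (x a) a ∧
      x a = ⋃ β, ⋃ (_ : β < a), x β := by
  obtain ⟨δ, hδ, hxδ⟩ := hx.delta
  have h : ∀ a, ∃ b, a < b ∧ δ a < b := fun a ↦ by
    obtain ⟨b, hb⟩ := exists_gt (max a (δ a))
    exact ⟨b, (le_max_left _ _).trans_lt hb, (le_max_right _ _).trans_lt hb⟩
  choose g hg hgδ using h
  refine ⟨_, isClub_closurePoints g, fun a ha ↦ ?_⟩
  have hcont := hx.continuous a (isSuccLimit_of_mem_closurePoints hg ha)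
  refine ⟨?_, hcont⟩
  have hle : a ≤ δ a := hδ.le_apply
  obtain h | h := hle.eq_or_lt
  · have := hxδ a
    rwa [← h] at this
  · have hmem : (a : Ordinal.{u}) ∈ x a ∩ Set.Iio ω₁ := by
      rw [show x a ∩ Set.Iio ω₁ = _ from hxδ a]
      exact h
    rw [hcont] at hmem
    obtain ⟨⟨_, ⟨b, rfl⟩, _, ⟨hb, rfl⟩, hab⟩, h1⟩ := hmem
    have hlt : (a : Ordinal.{u}) ∈ x b ∩ Set.Iio ω₁ := ⟨hab, h1⟩
    rw [show x b ∩ Set.Iio ω₁ = _ from hxδ b] at hlt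
    exact absurd ((hgδ b).trans (ha.2 b hb)) (not_lt.2 (le_of_lt hlt))

theorem mk_omega1 : #Omega1.{u} = ℵ₁ := by
  rw [Cardinal.mk_Iio_ordinal, ← Cardinal.ord_aleph, Cardinal.card_ord]
  simp

theorem mk_iUnion_le_aleph_one {ι α : Type (u + 1)} {f : ι → Set α} (hι : #ι ≤ ℵ₁)
    (hf : ∀ i, #(f i) ≤ ℵ₁) : #(⋃ i, f i) ≤ ℵ₁ := by
  refine (Cardinal.mk_iUnion_le f).trans ?_
  refine (mul_le_mul' hι (ciSup_le' hf)).trans ?_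
  rw [Cardinal.mul_eq_self Cardinal.aleph0_lt_aleph_one.le]

/-- Under `SRP` the nonstationary ideal on `ω₁` is saturated. -/
theorem IsPredense.exists_subset (hSRP : SRP.{u}) {𝓐 : Set (Set Omega1.{u})} (h𝓐 : IsPredense 𝓐) :
    ∃ 𝓑 ⊆ 𝓐, IsPredense 𝓑 ∧ #𝓑 ≤ ℵ₁ := by
  set κ : Cardinal.{u} := 2 ^ (ℵ₁ : Cardinal.{u}) with hκdef
  have hκ : ℵ₁ < κ := Cardinal.cantor _
  obtain ⟨e, he⟩ := exists_enumeration.{u}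
  rw [← hκdef] at he
  -- `x` is good when it contains an index of a member of `𝓐` to which `δ_x` belongs; predensity
  -- makes this projective stationary.
  let S : Set (Set Ordinal.{u}) := {x ∈ ctbl κ | ∃ j ∈ x, e j ∈ 𝓐 ∧ ∃ δ ∈ e j, HasDelta x δ}
  have hS : IsProjectiveStationary κ S := by
    refine ⟨fun x hx ↦ hx.1, fun A hA ↦ ⟨fun x hx ↦ hx.1.1, fun C hC ↦ ?_⟩⟩
    obtain ⟨B, hB, hAB⟩ := h𝓐 A hA
    obtain ⟨j, hj, rfl⟩ := he B
    obtain ⟨F, hF, hFC⟩ := hC.exists_closedUnder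
    obtain ⟨x, hx, hxF, hjx, δ, hδ, hxδ⟩ := exists_closedUnder_hasDelta hκ.le hF
      (y := {j}) ⟨Set.singleton_subset_iff.2 hj, Set.countable_singleton j⟩ hAB
    exact ⟨x, ⟨⟨hx, j, hjx rfl, hB, δ, hδ.2, hxδ⟩, δ, hδ.1, hxδ⟩, hFC x hx hxF⟩
  obtain ⟨x, hx, hxS⟩ := hSRP κ hκ S hS
  obtain ⟨C, hC, hCx⟩ := hx.exists_isClub_hasDelta
  refine ⟨{B ∈ 𝓐 | ∃ j ∈ ⋃ a, x a, e j = B}, fun B hB ↦ hB.1, fun A hA ↦ ?_, ?_⟩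
  -- By continuity the index at `a` appears in `x b` for some `b < a`. Fodor fixes `b`, and
  -- countability of `x b` then fixes the index.
  · obtain ⟨b, hb⟩ := exists_isStationary_fiber (hA.inter_isClub hC)
      (fun a b ↦ ∃ j ∈ x b, e j ∈ 𝓐 ∧ a ∈ e j) (by
        intro a ha
        obtain ⟨-, j, hj, hj𝓐, δ, hδ, hxδ⟩ := hxS a
        obtain ⟨hxa, hxc⟩ := hCx a ha.2
        rw [hxδ.unique hxa] at hδ
        rw [hxc] at hj
        obtain ⟨_, ⟨b, rfl⟩, _, ⟨hb, rfl⟩, hjb⟩ := hj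
        exact ⟨b, hb, j, hjb, hj𝓐, hδ⟩)
    obtain ⟨j, hj, hjs⟩ := exists_isStationary_of_countable (hx.mem b).2 hb
      (fun a j ↦ e j ∈ 𝓐 ∧ a ∈ e j) fun a ha ↦ ha.2
    obtain ⟨a, -, ha, -⟩ := hjs.nonempty
    exact ⟨e j, ⟨ha, j, Set.mem_iUnion.2 ⟨b, hj⟩, rfl⟩,
      hjs.mono fun a ha ↦ ⟨ha.1.1.1, ha.2.2⟩⟩
  · have hsub : {B ∈ 𝓐 | ∃ j ∈ ⋃ a, x a, e j = B} ⊆ e '' ⋃ a, x a := fun B hB ↦ hB.2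
    refine (Cardinal.mk_le_mk_of_subset hsub).trans (Cardinal.mk_image_le.trans ?_)
    refine mk_iUnion_le_aleph_one mk_omega1.le fun a ↦ ?_
    exact (Cardinal.le_aleph0_iff_set_countable.2 (hx.mem a).2).trans
      Cardinal.aleph0_lt_aleph_one.le

/-! ### Order types of countable sets of ordinals -/

theorem lt_omega_two_iff {η : Ordinal.{u}} : η < ω_ 2 ↔ #(Set.Iio η) ≤ ℵ₁ := by
  rw [Cardinal.mk_Iio_ordinal, ← Cardinal.ord_aleph, Cardinal.lt_ord]
  have h : (ℵ_ 2 : Cardinal.{u}) = Order.succ ℵ₁ := by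
    rw [Cardinal.succ_aleph, one_add_one_eq_two]
  rw [h, Order.lt_succ_iff, ← Cardinal.lift_le.{u + 1}]
  simp

theorem typeLT_inter_Iio {y : Set Ordinal.{u}} {η : Ordinal.{u}} (h : η ∈ y) :
    typeLT (y ∩ Set.Iio η : Set Ordinal.{u}) = Ordinal.typein (α := y) (· < ·) ⟨η, h⟩ := by
  rw [← Ordinal.type_Iio_lt]
  refine Ordinal.type_eq.2 ⟨⟨⟨fun a ↦ ⟨⟨a, a.2.1⟩, a.2.2⟩, fun a ↦ ⟨a.1, a.1.2, a.2⟩,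
    fun a ↦ rfl, fun a ↦ rfl⟩, Iff.rfl⟩⟩

theorem exists_lift_eq_typeLT {y : Set Ordinal.{u}} (hy : y.Countable) :
    ∃ o : Omega1.{u}, Ordinal.lift.{u + 1} (o : Ordinal.{u}) = typeLT y := by
  have h : typeLT y < ω₁ := by
    rw [← Cardinal.ord_aleph, Cardinal.lt_ord, Ordinal.card_type, Cardinal.lt_aleph_one_iff]
    exact hy.le_aleph0
  have h' : (ω₁ : Ordinal.{u + 1}) = Ordinal.lift.{u + 1} (ω₁ : Ordinal.{u}) := by simp
  rw [h'] at h
  obtain ⟨o, ho⟩ := Ordinal.mem_range_lift_of_le h.le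
  rw [← ho, Ordinal.lift_lt] at h
  exact ⟨⟨o, h⟩, ho⟩

/-- The order type of a countable set of ordinals. -/
noncomputable def otype (y : Set Ordinal.{u}) : Omega1.{u} :=
  Classical.epsilon fun o ↦ Ordinal.lift.{u + 1} (o : Ordinal.{u}) = typeLT y

theorem lift_otype {y : Set Ordinal.{u}} (hy : y.Countable) :
    Ordinal.lift.{u + 1} (otype y : Ordinal.{u}) = typeLT y :=
  Classical.epsilon_spec (exists_lift_eq_typeLT hy)

theorem otype_inter_Iio_lt {y : Set Ordinal.{u}} (hy : y.Countable) {η : Ordinal.{u}}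
    (h : η ∈ y) : otype (y ∩ Set.Iio η) < otype y := by
  rw [← Subtype.coe_lt_coe, ← Ordinal.lift_lt.{u + 1}, lift_otype hy,
    lift_otype (hy.mono Set.inter_subset_left), typeLT_inter_Iio h]
  exact Ordinal.typein_lt_type _ _

theorem otype_inter_Iio_lt_inter_Iio {y : Set Ordinal.{u}} (hy : y.Countable) {η ζ : Ordinal.{u}}
    (h : η ∈ y) (hηζ : η < ζ) : otype (y ∩ Set.Iio η) < otype (y ∩ Set.Iio ζ) := by
  have := otype_inter_Iio_lt (hy.mono Set.inter_subset_left) (y := y ∩ Set.Iio ζ) ⟨h, hηζ⟩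
  rwa [Set.inter_assoc, Set.Iio_inter_Iio, min_eq_right hηζ.le] at this

theorem exists_otype_inter_Iio_eq {y : Set Ordinal.{u}} (hy : y.Countable) {o : Omega1.{u}}
    (ho : o < otype y) : ∃ η ∈ y, otype (y ∩ Set.Iio η) = o := by
  rw [← Subtype.coe_lt_coe, ← Ordinal.lift_lt.{u + 1}, lift_otype hy] at ho
  obtain ⟨η, hη⟩ := Ordinal.typein_surj _ ho
  refine ⟨η, η.2, Subtype.ext (Ordinal.lift_inj.{u + 1}.1 ?_)⟩
  rw [lift_otype (hy.mono Set.inter_subset_left), typeLT_inter_Iio η.2, hη]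

/-! ### Canonical functions -/

theorem exists_collapse : ∃ r : Ordinal.{u} → Ordinal.{u} → Ordinal.{u}, ∀ η < ω_ 2,
    (∀ ξ < η, r η ξ < ω₁) ∧ Set.InjOn (r η) (Set.Iio η) := by
  have h : ∀ η : Ordinal.{u}, ∃ f : Ordinal.{u} → Ordinal.{u}, η < ω_ 2 →
      (∀ ξ < η, f ξ < ω₁) ∧ Set.InjOn f (Set.Iio η) := by
    intro η
    by_cases hη : η < ω_ 2
    · rw [lt_omega_two_iff, ← mk_omega1] at hη
      obtain ⟨f⟩ := hη
      let g : Ordinal.{u} → Ordinal.{u} := Function.extend Subtype.val (fun ξ ↦ f ξ) id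
      have hg : ∀ ξ : Set.Iio η, g ξ = f ξ := fun ξ ↦ Subtype.val_injective.extend_apply _ _ ξ
      refine ⟨g, fun _ ↦ ⟨fun ξ hξ ↦ ?_, fun ξ hξ ζ hζ h ↦ ?_⟩⟩
      · rw [hg ⟨ξ, hξ⟩]
        exact (f _).2
      · rw [hg ⟨ξ, hξ⟩, hg ⟨ζ, hζ⟩] at h
        exact congrArg Subtype.val (f.injective (Subtype.ext h))
    · exact ⟨id, fun h ↦ (hη h).elim⟩
  choose r hr using h
  exact ⟨r, hr⟩

/-- Injections `collapse η : η → ω₁` for `η < ω₂`. -/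
noncomputable def collapse : Ordinal.{u} → Ordinal.{u} → Ordinal.{u} := exists_collapse.choose

theorem collapse_lt {η ξ : Ordinal.{u}} (hη : η < ω_ 2) (hξ : ξ < η) : collapse η ξ < ω₁ :=
  (exists_collapse.choose_spec η hη).1 ξ hξ

theorem collapse_injOn {η : Ordinal.{u}} (hη : η < ω_ 2) : Set.InjOn (collapse η) (Set.Iio η) :=
  (exists_collapse.choose_spec η hη).2

/-- The canonical functions `ω₁ → ω₁`, indexed by the ordinals below `ω₂`. -/
noncomputable def canonical (η : Ordinal.{u}) (a : Omega1.{u}) : Omega1.{u} :=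
  otype {ξ | ξ < η ∧ collapse η ξ < a}

/-- Set-valued functions of finitely many arguments from functions of two arguments. -/
def pairwise (G : Ordinal.{u} → Ordinal.{u} → Set Ordinal.{u}) (l : List Ordinal.{u}) :
    Set Ordinal.{u} :=
  ⋃ p ∈ {p : Ordinal.{u} × Ordinal.{u} | p.1 ∈ l ∧ p.2 ∈ l}, G p.1 p.2

theorem mapsToCtbl_pairwise {κ : Cardinal.{u}} {G : Ordinal.{u} → Ordinal.{u} → Set Ordinal.{u}}
    (hG : ∀ a < κ.ord, ∀ b < κ.ord, G a b ∈ ctbl κ) : MapsToCtbl κ (pairwise G) := by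
  intro l hl
  refine biUnion_mem_ctbl ?_ fun p hp ↦ hG _ (hl _ hp.1) _ (hl _ hp.2)
  exact l.finite_toSet.countable.prod l.finite_toSet.countable

theorem ClosedUnder.pairwise {G : Ordinal.{u} → Ordinal.{u} → Set Ordinal.{u}}
    {x : Set Ordinal.{u}} (hx : ClosedUnder (pairwise G) x) {a b : Ordinal.{u}} (ha : a ∈ x)
    (hb : b ∈ x) : G a b ⊆ x := by
  refine Set.Subset.trans ?_ (hx [a, b] (by simp [ha, hb]))
  exact Set.subset_biUnion_of_mem
    (s := {p : Ordinal.{u} × Ordinal.{u} | p.1 ∈ [a, b] ∧ p.2 ∈ [a, b]})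
    (u := fun p : Ordinal.{u} × Ordinal.{u} ↦ G p.1 p.2) (x := (a, b)) (by simp)

/-- The functions under which a set `x` has to be closed for `δ_x` to be defined and for `x ∩ η`
to be determined by `δ_x` for each `η ∈ x ∩ ω₂`. -/
def coherence (a b : Ordinal.{u}) : Set Ordinal.{u} :=
  {c | a < ω₁ ∧ c < a} ∪ {c | a < ω_ 2 ∧ b < a ∧ c = collapse a b} ∪
    {c | a < ω_ 2 ∧ c < a ∧ collapse a c = b}

theorem coherence_mem_ctbl {κ : Cardinal.{u}} (hκ : ℵ₁ ≤ κ) {a b : Ordinal.{u}} (ha : a < κ.ord) :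
    coherence a b ∈ ctbl κ := by
  refine union_mem_ctbl (union_mem_ctbl ⟨?_, ?_⟩ ⟨?_, ?_⟩) ⟨?_, ?_⟩
  · exact fun c hc ↦ hc.2.trans ha
  · by_cases h : a < ω₁
    · exact (countable_Iio_of_lt_omega_one h).mono fun c hc ↦ hc.2
    · simp [h]
  · rintro c ⟨h2, hb, rfl⟩
    exact (collapse_lt h2 hb).trans_le (omega_one_le_ord hκ)
  · exact (Set.countable_singleton (collapse a b)).mono fun c hc ↦ hc.2.2
  · exact fun c hc ↦ hc.2.1.trans ha
  · exact Set.Subsingleton.countable fun c hc d hd ↦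
      collapse_injOn hc.1 hc.2.1 hd.2.1 (hc.2.2.trans hd.2.2.symm)

/-- Closure under `coherence`. -/
def Coherent (x : Set Ordinal.{u}) : Prop :=
  ∀ a ∈ x, ∀ b ∈ x, coherence a b ⊆ x

theorem Coherent.exists_hasDelta {x : Set Ordinal.{u}} (hx : Coherent x) (hxc : x.Countable) :
    ∃ δ, HasDelta x δ := by
  have hne : {a : Omega1.{u} | (a : Ordinal.{u}) ∉ x}.Nonempty := by
    obtain ⟨a, ha⟩ := exists_gt_of_countable
      (hxc.preimage (f := fun c : Omega1.{u} ↦ (c : Ordinal.{u})) Subtype.val_injective)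
    exact ⟨a, fun h ↦ (ha a h).false⟩
  -- `δ_x` is the least countable ordinal missing from `x`.
  refine ⟨wellFounded_lt.min _ hne, Set.Subset.antisymm ?_ ?_⟩
  · rintro a ⟨ha, ha1⟩
    by_contra h
    rw [Set.mem_Iio, not_lt] at h
    refine wellFounded_lt.min_mem _ hne ?_
    obtain h | h := h.eq_or_lt
    · exact h ▸ ha
    · exact hx a ha a ha (.inl (.inl ⟨ha1, h⟩))
  · intro a ha
    have ha1 : a < ω₁ := lt_trans ha (wellFounded_lt.min _ hne).2
    refine ⟨?_, ha1⟩
    by_contra h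
    exact wellFounded_lt.not_lt_min _ (x := (⟨a, ha1⟩ : Omega1.{u})) h ha

theorem HasDelta.mem_iff {x : Set Ordinal.{u}} {δ : Omega1.{u}} (hδ : HasDelta x δ)
    {a : Ordinal.{u}} (ha : a < ω₁) : a ∈ x ↔ a < δ := by
  have h : a ∈ x ∩ Set.Iio ω₁ ↔ a ∈ Set.Iio (δ : Ordinal.{u}) := by
    rw [show x ∩ Set.Iio ω₁ = _ from hδ]
  simpa [ha] using h

/-- Closure under `collapse η` and its inverse gives `x ∩ η = {ξ < η | collapse η ξ < δ}`. -/
theorem Coherent.otype_inter_Iio {x : Set Ordinal.{u}} (hx : Coherent x) {δ : Omega1.{u}}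
    (hδ : HasDelta x δ) {η : Ordinal.{u}} (hη : η ∈ x) (hη2 : η < ω_ 2) :
    otype (x ∩ Set.Iio η) = canonical η δ := by
  refine congrArg otype (Set.ext fun ξ ↦ ⟨fun h ↦ ⟨h.2, ?_⟩, fun h ↦ ⟨?_, h.1⟩⟩)
  · exact (hδ.mem_iff (collapse_lt hη2 h.2)).1 (hx η hη ξ h.1 (.inl (.inr ⟨hη2, h.2, rfl⟩)))
  · exact hx η hη _ ((hδ.mem_iff (collapse_lt hη2 h.1)).2 h.2) (.inr ⟨hη2, h.1, rfl⟩)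

/-- Otherwise some coherent `x` containing `η` and `ζ` has `δ_x` in this set, yet `x ∩ η` is a
proper initial segment of `x ∩ ζ`. -/
theorem not_isStationary_canonical_le {η ζ : Ordinal.{u}} (hηζ : η < ζ) (hζ : ζ < ω_ 2) :
    ¬ IsStationary {a | canonical ζ a ≤ canonical η a} := by
  intro hA
  have h12 : (ℵ₁ : Cardinal.{u}) ≤ ℵ_ 2 := Cardinal.aleph_le_aleph.2 one_le_two
  obtain ⟨x, hx, hxF, hyx, δ, hδ, hxδ⟩ := exists_closedUnder_hasDelta h12
    (mapsToCtbl_pairwise fun a ha b _ ↦ coherence_mem_ctbl (b := b) h12 ha) (y := {η, ζ})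
    ⟨by
      rw [Cardinal.ord_aleph]
      rintro a (rfl | rfl)
      exacts [hηζ.trans hζ, hζ], (Set.toFinite _).countable⟩ hA
  have hxc : Coherent x := fun a ha b hb ↦ hxF.pairwise ha hb
  have hη : η ∈ x := hyx (.inl rfl)
  have h := otype_inter_Iio_lt_inter_Iio hx.2 hη hηζ
  rw [hxc.otype_inter_Iio hxδ hη (hηζ.trans hζ), hxc.otype_inter_Iio hxδ (hyx (.inr rfl)) hζ] at h
  exact h.not_ge hδ

/-! ### Functions on `ω₁` are bounded by canonical functions -/

/-- Adding all sets almost disjoint from every `A η` makes the antichain predense. A predense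
subfamily of size at most `ℵ₁` must still contain each `A η`, since no other member meets `A η` in a
stationary set. -/
theorem mk_le_aleph_one_of_antichain (hSRP : SRP.{u}) {I : Set Ordinal.{u}}
    {A : Ordinal.{u} → Set Omega1.{u}} (hA : ∀ η ∈ I, IsStationary (A η))
    (hd : ∀ η ∈ I, ∀ ζ ∈ I, η < ζ → ¬ IsStationary (A η ∩ A ζ)) : #I ≤ ℵ₁ := by
  have hd' : ∀ η ∈ I, ∀ ζ ∈ I, IsStationary (A η ∩ A ζ) → η = ζ := by
    intro η hη ζ hζ h
    obtain hlt | heq | hlt := lt_trichotomy η ζ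
    · exact (hd η hη ζ hζ hlt h).elim
    · exact heq
    · exact (hd ζ hζ η hη hlt (Set.inter_comm (A η) _ ▸ h)).elim
  have hpre : IsPredense {B | (∃ η ∈ I, A η = B) ∨ ∀ η ∈ I, ¬ IsStationary (A η ∩ B)} := by
    intro B hB
    by_cases h : ∃ η ∈ I, IsStationary (B ∩ A η)
    · obtain ⟨η, hη, hs⟩ := h
      exact ⟨A η, .inl ⟨η, hη, rfl⟩, hs⟩
    · push Not at h
      refine ⟨B, .inr fun η hη ↦ ?_, by rwa [Set.inter_self]⟩
      rw [Set.inter_comm]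
      exact h η hη
  obtain ⟨𝓑, h𝓑, h𝓑pre, hcard⟩ := hpre.exists_subset hSRP
  have hinj : Set.InjOn A I := fun η hη ζ hζ h ↦ hd' η hη ζ hζ (by
    rw [← h, Set.inter_self]
    exact hA η hη)
  have hsub : A '' I ⊆ 𝓑 := by
    rintro _ ⟨η, hη, rfl⟩
    obtain ⟨B, hB, hs⟩ := h𝓑pre _ (hA η hη)
    obtain ⟨ζ, hζ, rfl⟩ | h := h𝓑 hB
    · rwa [hd' η hη ζ hζ hs]
    · exact (h η hη hs).elim
  rw [← Cardinal.mk_image_eq_of_injOn A I hinj]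
  exact (Cardinal.mk_le_mk_of_subset hsub).trans hcard

/-- Otherwise, on one stationary `A`, each canonical function is at most `h` off a nonstationary
set. Coding its values by naturals via injections of `Iic (h a)` gives each `η < ω₂` a stationary
set with constant code. Sets with equal code form an antichain, so only `ℵ₁` many `η` exist. -/
theorem isPredense_canonical (hSRP : SRP.{u}) (h : Omega1.{u} → Omega1.{u}) :
    IsPredense {B | ∃ η < ω_ 2, {a | h a < canonical η a} = B} := by
  intro A hA
  by_contra! hcon
  have hstat : ∀ η < ω_ 2, IsStationary {a ∈ A | canonical η a ≤ h a} := by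
    intro η hη
    have hu : IsStationary ({a ∈ A | canonical η a ≤ h a} ∪ A ∩ {a | h a < canonical η a}) :=
      hA.mono fun a ha ↦ (le_or_gt (canonical η a) (h a)).imp (⟨ha, ·⟩) (⟨ha, ·⟩)
    exact ((isStationary_union_iff cof_omega1).1 hu).resolve_right (hcon _ ⟨η, hη, rfl⟩)
  have henc : ∀ a : Omega1.{u}, ∃ f : Omega1.{u} → ℕ, Set.InjOn f (Set.Iic a) := fun a ↦
    Set.countable_iff_exists_injOn.1 (countable_Iic_omega1 a)
  choose enc henc using henc
  have hcode : ∀ η : Ordinal.{u}, ∃ n, η < ω_ 2 →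
      IsStationary {a ∈ {a ∈ A | canonical η a ≤ h a} | enc (h a) (canonical η a) = n} := by
    intro η
    by_cases hη : η < ω_ 2
    · obtain ⟨n, -, hn⟩ := exists_isStationary_of_countable (Set.to_countable Set.univ)
        (hstat η hη) (fun a n ↦ enc (h a) (canonical η a) = n)
        fun a _ ↦ ⟨_, Set.mem_univ _, rfl⟩
      exact ⟨n, fun _ ↦ hn⟩
    · exact ⟨0, fun h ↦ (hη h).elim⟩
  choose code hcode using hcode
  have hI : ∀ n : ULift.{u + 1} ℕ, #{η : Ordinal.{u} | η < ω_ 2 ∧ code η = n.down} ≤ ℵ₁ := by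
    rintro ⟨n⟩
    refine mk_le_aleph_one_of_antichain hSRP
      (A := fun η ↦ {a ∈ {a ∈ A | canonical η a ≤ h a} | enc (h a) (canonical η a) = n}) ?_ ?_
    · rintro η ⟨hη, rfl⟩
      exact hcode η hη
    · rintro η - ζ ⟨hζ, -⟩ hηζ hs
      refine not_isStationary_canonical_le hηζ hζ (hs.mono fun a ha ↦ ?_)
      exact (henc (h a) ha.1.1.2 ha.2.1.2 (ha.1.2.trans ha.2.2.symm)).ge
  refine lt_irrefl (ω_ 2 : Ordinal.{u}) (lt_omega_two_iff.2 ?_)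
  refine (Cardinal.mk_le_mk_of_subset ?_).trans (mk_iUnion_le_aleph_one ?_ hI)
  · exact fun η hη ↦ Set.mem_iUnion.2 ⟨⟨code η⟩, hη, rfl⟩
  · exact (Cardinal.mk_le_aleph0).trans Cardinal.aleph0_lt_aleph_one.le

theorem exists_lt_canonical (hSRP : SRP.{u}) (h : Omega1.{u} → Omega1.{u}) :
    ∃ η < ω_ 2, ¬ IsStationary {a | canonical η a ≤ h a} := by
  obtain ⟨𝓑, h𝓑, hpre, hcard⟩ := (isPredense_canonical hSRP h).exists_subset hSRP
  have hindex : ∀ B ∈ 𝓑, ∃ η < ω_ 2, {a | h a < canonical η a} = B := fun B hB ↦ h𝓑 hB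
  choose! η hη hηB using hindex
  -- Regularity of `ω₂`: at most `ℵ₁` many indices cannot be cofinal in it.
  have hbdd : ∃ ζ < ω_ 2, ∀ B ∈ 𝓑, η B < ζ := by
    by_contra! hcon
    refine lt_irrefl (ω_ 2 : Ordinal.{u}) (lt_omega_two_iff.2 ?_)
    have hsub : Set.Iio (ω_ 2) ⊆ ⋃ B : 𝓑, Set.Iio (Order.succ (η B)) := fun ζ hζ ↦ by
      obtain ⟨B, hB, hζB⟩ := hcon ζ hζ
      exact Set.mem_iUnion.2 ⟨⟨B, hB⟩, Order.lt_succ_of_le hζB⟩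
    refine (Cardinal.mk_le_mk_of_subset hsub).trans (mk_iUnion_le_aleph_one hcard fun B ↦ ?_)
    exact lt_omega_two_iff.1 ((Cardinal.isSuccLimit_omega 2).succ_lt (hη B B.2))
  obtain ⟨ζ, hζ, hlt⟩ := hbdd
  refine ⟨ζ, hζ, fun hs ↦ ?_⟩
  obtain ⟨B, hB, hsB⟩ := hpre _ hs
  refine not_isStationary_canonical_le (hlt B hB) hζ (hsB.mono fun a ha ↦ ?_)
  have hlt : a ∈ {a | h a < canonical (η B) a} := by
    rw [hηB B hB]
    exact ha.2
  exact (ha.1 : canonical ζ a ≤ h a).trans (le_of_lt (Set.mem_ofPred_eq ▸ hlt))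

/-! ### Order types of members of a stationary set -/

/-- The members of a club of `ω₁`, viewed as initial segments, form a club in `[ω₁]^ω`, and each is
its own order type. -/
theorem isStationary_orderTypes_aleph_one {S : Set (Set Ordinal.{u})} (hS : IsStationaryIn ℵ₁ S) :
    IsStationary (orderTypes S) := by
  intro C hC
  have hclub : IsClubIn ℵ₁ ((fun a : Omega1.{u} ↦ Set.Iio (a : Ordinal.{u})) '' C) := by
    refine ⟨?_, fun y hy ↦ ?_, fun f hf hfC ↦ ?_⟩
    · rintro _ ⟨a, -, rfl⟩
      exact Iio_mem_ctbl le_rfl a.2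
    · obtain ⟨a, ha⟩ := exists_gt_of_countable
        (hy.2.preimage (f := fun c : Omega1.{u} ↦ (c : Ordinal.{u})) Subtype.val_injective)
      obtain ⟨b, hb, hab⟩ := hC.isCofinal a
      refine ⟨_, ⟨b, hb, rfl⟩, fun c hc ↦ ?_⟩
      have hc1 : c < ω₁ := by
        rw [← Cardinal.ord_aleph]
        exact hy.1 hc
      exact (ha ⟨c, hc1⟩ hc).trans_le hab
    · choose a haC ha using hfC
      obtain ⟨c, hc⟩ := exists_isLUB_of_countable (Set.countable_range a)
      refine ⟨c, hC.isLUB_mem (Set.range_subset_iff.2 haC) (Set.range_nonempty a) hc, ?_⟩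
      refine Set.Subset.antisymm (fun b hb ↦ ?_) (Set.iUnion_subset fun n ↦ ?_)
      · obtain ⟨_, ⟨n, rfl⟩, hn⟩ :=
          (lt_isLUB_iff (b := (⟨b, (Set.mem_Iio.1 hb).trans c.2⟩ : Omega1.{u})) hc).1 hb
        exact Set.mem_iUnion.2 ⟨n, ha n ▸ hn⟩
      · rw [← ha n]
        exact Set.Iio_subset_Iio (hc.1 ⟨n, rfl⟩)
  obtain ⟨_, hS, a, ha, rfl⟩ := hS.inter_nonempty _ hclub
  refine ⟨a, ⟨_, hS, ?_⟩, ha⟩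
  have h12 : (ω₁ : Ordinal.{u}) ≤ ω_ 2 := Ordinal.omega_le_omega.2 one_le_two
  have htype : ∀ y, y = Set.Iio (a : Ordinal.{u}) →
      Ordinal.lift.{u + 1} (a : Ordinal.{u}) = typeLT y := by
    rintro _ rfl
    exact (Ordinal.type_lt_Iio _).symm
  exact htype _ (by rw [Set.Iio_inter_Iio, min_eq_left ((le_of_lt a.2).trans h12)])

/-- A point closed under a function jumping upwards into `C` is a limit of `C`. -/
theorem mem_of_mem_closurePoints {C : Set Omega1.{u}} (hC : IsClub C) {d : Omega1.{u} → Omega1.{u}}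
    (hd : ∀ a, a < d a) (hdC : ∀ a, d a ∈ C) {δ : Omega1.{u}} (hδ : δ ∈ closurePoints d) :
    δ ∈ C := by
  obtain ⟨b, hb⟩ := hδ.1
  refine hC.isLUB_mem (t := d '' Set.Iio δ) (Set.image_subset_iff.2 fun a _ ↦ hdC a)
    ⟨d b, b, hb, rfl⟩ ⟨?_, fun c hc ↦ ?_⟩
  · rintro _ ⟨a, ha, rfl⟩
    exact (hδ.2 a ha).le
  · by_contra! h
    exact (hd c).not_ge (hc ⟨c, h, rfl⟩)

theorem isStationary_orderTypes_of_aleph_two_le (hSRP : SRP.{u}) {κ : Cardinal.{u}}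
    (hκ : ℵ_ 2 ≤ κ) {S : Set (Set Ordinal.{u})} (hS : IsStationaryIn κ S) :
    IsStationary (orderTypes S) := by
  intro C hC
  have h1 : (ℵ₁ : Cardinal.{u}) ≤ κ := (Cardinal.aleph_le_aleph.2 one_le_two).trans hκ
  have hκ1 := omega_one_le_ord h1
  have hκ2 : ω_ 2 ≤ κ.ord := by
    rw [← Cardinal.ord_aleph]
    exact Cardinal.ord_le_ord.2 hκ
  have hnext : ∀ η a, ∃ b ∈ C, canonical.{u} η a ≤ b := fun η a ↦ hC.isCofinal _
  choose h hhC hh using hnext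
  have hbound : ∀ η, ∃ ζ < ω_ 2, ∃ D, IsClub D ∧ ∀ a ∈ D, h η a < canonical ζ a := by
    intro η
    obtain ⟨ζ, hζ, hns⟩ := exists_lt_canonical hSRP (h η)
    obtain ⟨D, hD, hdisj⟩ := not_isStationary_iff.1 hns
    exact ⟨ζ, hζ, D, hD, fun a ha ↦ not_le.1 fun hle ↦ hdisj.notMem_of_mem_left hle ha⟩
  choose β hβ D hD hβD using hbound
  have hd : ∀ η a, ∃ b ∈ D η, a < b := by
    intro η a
    obtain ⟨a', ha'⟩ := exists_gt a
    obtain ⟨b, hb, hab⟩ := (hD η).isCofinal a'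
    exact ⟨b, hb, ha'.trans_le hab⟩
  choose d hdD hd using hd
  -- Closure under `d` places `δ_x` in `D η` for every `η ∈ x`: a diagonal intersection indexed by
  -- `x`.
  let G : Ordinal.{u} → Ordinal.{u} → Set Ordinal.{u} := fun a b ↦
    coherence a b ∪ {0, β a} ∪ {c | ∃ hb : b < ω₁, c = d a ⟨b, hb⟩}
  -- `pairwise G` is empty at the empty list; adding `0` makes `x` nonempty and `δ_x` positive.
  let F : List Ordinal.{u} → Set Ordinal.{u} := fun l ↦ {0} ∪ pairwise G l
  have h0 : (0 : Ordinal.{u}) < κ.ord := (Ordinal.omega_pos 1).trans_le hκ1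
  have hG : MapsToCtbl κ (pairwise G) := by
    refine mapsToCtbl_pairwise fun a ha b _ ↦
      union_mem_ctbl (union_mem_ctbl (coherence_mem_ctbl h1 ha) ⟨?_, ?_⟩) ⟨?_, ?_⟩
    · rintro c (rfl | rfl)
      exacts [h0, (hβ a).trans_le hκ2]
    · exact (Set.toFinite _).countable
    · rintro c ⟨hb, rfl⟩
      exact (d a ⟨b, hb⟩).2.trans_le hκ1
    · exact Set.Subsingleton.countable fun c ⟨_, hc⟩ e ⟨_, he⟩ ↦ hc.trans he.symm
  have hF : MapsToCtbl κ F := fun l hl ↦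
    union_mem_ctbl ⟨Set.singleton_subset_iff.2 h0, Set.countable_singleton 0⟩ (hG l hl)
  obtain ⟨x, hxS, hx, hxF⟩ := hS.inter_nonempty _ (isClubIn_closedUnder hF)
  have hx0 : 0 ∈ x := hxF [] (by simp) (.inl rfl)
  have hxG : ∀ a ∈ x, ∀ b ∈ x, G a b ⊆ x := fun a ha b hb ↦
    ClosedUnder.pairwise (fun l hl ↦ Set.subset_union_right.trans (hxF l hl)) ha hb
  have hxc : Coherent x := fun a ha b hb c hc ↦ hxG a ha b hb (.inl (.inl hc))
  have hxβ : ∀ a ∈ x, β a ∈ x := fun a ha ↦ hxG a ha a ha (.inl (.inr (.inr rfl)))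
  obtain ⟨δ, hδ⟩ := hxc.exists_hasDelta hx.2
  have hδD : ∀ η ∈ x, δ ∈ D η := by
    intro η hη
    refine mem_of_mem_closurePoints (hD η) (hd η) (hdD η) ⟨?_, fun a ha ↦ ?_⟩
    · exact ⟨⟨0, Ordinal.omega_pos 1⟩, (hδ.mem_iff (Ordinal.omega_pos 1)).1 hx0⟩
    · exact (hδ.mem_iff (d η a).2).1
        (hxG η hη a ((hδ.mem_iff a.2).2 ha) (.inr ⟨a.2, rfl⟩))
  have hyc : (x ∩ Set.Iio (ω_ 2)).Countable := hx.2.mono Set.inter_subset_left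
  have hlt : ∀ η ∈ x, h η δ < canonical (β η) δ := fun η hη ↦ hβD η δ (hδD η hη)
  refine ⟨otype (x ∩ Set.Iio (ω_ 2)), ⟨x, hxS, lift_otype hyc⟩, ?_⟩
  -- Upper bound: `h η δ` is below the order type of `x ∩ β η`. Least: any smaller ordinal is
  -- `canonical η δ` with `η ∈ x ∩ ω₂`, hence below `canonical (β η) δ ≤ h (β η) δ`.
  refine hC.isLUB_mem (t := (fun η ↦ h η δ) '' (x ∩ Set.Iio (ω_ 2)))
    (Set.image_subset_iff.2 fun η _ ↦ hhC η δ) ⟨h 0 δ, 0, ⟨hx0, Ordinal.omega_pos 2⟩, rfl⟩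
    ⟨?_, fun o ho ↦ ?_⟩
  · rintro _ ⟨η, ⟨hη, -⟩, rfl⟩
    have hle := otype_inter_Iio_lt_inter_Iio hx.2 (hxβ η hη) (hβ η)
    rw [hxc.otype_inter_Iio hδ (hxβ η hη) (hβ η)] at hle
    exact ((hlt η hη).trans hle).le
  · by_contra! hcon
    obtain ⟨η, ⟨hη, hη2⟩, rfl⟩ := exists_otype_inter_Iio_eq hyc hcon
    rw [Set.inter_assoc, Set.Iio_inter_Iio, min_eq_right (le_of_lt hη2),
      hxc.otype_inter_Iio hδ hη hη2] at ho
    have hle : h (β η) δ ≤ canonical η δ := ho ⟨β η, ⟨hxβ η hη, hβ η⟩, rfl⟩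
    exact (hlt η hη).not_ge ((hh (β η) δ).trans (hle.trans (hh η δ)))

end CountableSubsets

theorem corollary7p2 (hSRP : CountableSubsets.SRP.{u}) (κ : Cardinal.{u}) (hκ : ℵ₁ ≤ κ)
    (S : Set (Set Ordinal.{u})) (hS : CountableSubsets.IsStationaryIn κ S) :
    IsStationary (CountableSubsets.orderTypes S) := by
  obtain rfl | hlt := hκ.eq_or_lt
  · exact CountableSubsets.isStationary_orderTypes_aleph_one hS
  · refine CountableSubsets.isStationary_orderTypes_of_aleph_two_le hSRP ?_ hS
    rw [← one_add_one_eq_two, ← Cardinal.succ_aleph]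
    exact Order.succ_le_of_lt hlt
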